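/- For $n\ge 1$ let $H(n)=1+\frac12+\cdots+\frac1n$ be the $n$-th harmonic number, and for a prime $p$ let $\nu_p$ denote the $p$-adic valuation on $\mathbb{Q}$. A prime $p\ge 5$ is called a Wolstenholme prime if $p$ divides the numerator of the Bernoulli number $B_{p-3}$. Let $p\geq 5$ be a prime that is not a Wolstenholme prime, and let $n$ be a positive integer with $p\nmid n$ and $\nu_p(H(n))\geq 3$. Below, $m$ and $M$ denote non-negative integers. 1. If $\nu_p(H(n))\geq 4$, then $\nu_p(H(pn))=2$, and from there on the valuations descend by one at each step: $\nu_p(H(p^m\cdot pn))=\nu_p(H(pn))-m=2-m$ for all $m\ge 0$. 2. If $\nu_p(H(n))=3$ and there is no $m$ with $\nu_p(H(p^mn))\leq 2$, then $\nu_p(H(p^mn))=2m+3$ for all $m\ge 0$. 3. If $\nu_p(H(n))=3$ and there is an $m$ with $\nu_p(H(p^mn))\leq 2$, then there is an $M$ such that $\nu_p(H(p^Mn))=0$ and, for all $m\ge 0$, $$\begin{cases}\nu_p(H(p^mn))=2m+3 & \text{if } m<\frac M3-1,\\ \nu_p(H(p^mn))\ge 2m+3 & \text{if } m=\frac M3-1,\\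 \nu_p(H(p^mn))=M-m & \text{if } m>\frac M3-1.\end{cases}$$ -/

import Mathlib

/-- A Wolstenholme prime: a prime `p` dividing (the numerator of) the Bernoulli number `B_{p-3}`.
It is only used for `p ≥ 5`, where the subtraction `p - 3` is not truncated. -/
def IsWolstenholmePrime (p : ℕ) : Prop :=
  p.Prime ∧ (p : ℤ) ∣ (bernoulli (p - 3)).num

/-- The `p`-adic valuation (an integer, possibly negative) of the `n`-th harmonic number
`H(n) = 1 + 1/2 + ⋯ + 1/n`. -/
def nuH (p n : ℕ) : ℤ := padicValRat p (harmonic n)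

/-! Splitting off the multiples of `p` gives H(pN) = H(N)/p + S(N), where S(N) sums 1/k over k < pN
prime to `p`. For N = p^m n with p ∤ n, S(N) has valuation exactly 2m+2
(`coprimeHarmonic_valuation`). Hence t(m) = m + ν_p(H(p^m n)) satisfies t(m+1) = min(t(m), 3m+3)
unless the two are equal, when only ≥ holds (`nuH_step`). The theorem follows from these integer
dynamics. For the valuation of S, put L = p^(s+1) u with p ∤ u. Pairing k with L - k reduces Σ 1/k
to -(L/2) Σ 1/k² (`two_mul_sum_natInv`). Cutting into blocks reduces that sum to p^s u Σ_{k<p} 1/k²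
(`sum_natInv_sq_congr`). Modulo p², a Kummer congruence and Faulhaber's formula give 3 Σ_{k<p} 1/k²
≡ 2 Σ_{k<p} k^(p-3) ≡ 2p B_{p-3}, which is nonzero when `p` is not Wolstenholme. -/

/-! ### Inverses of natural numbers in `ℤ_[p]` -/

section InverseSums

variable {p : ℕ} [Fact p.Prime]

/-- The inverse of `k` in `ℤ_[p]`, with the value `0` when `p ∣ k`. -/
noncomputable def natInv (p : ℕ) [Fact p.Prime] (k : ℕ) : ℤ_[p] := Ring.inverse (k : ℤ_[p])

lemma isUnit_natCast_padicInt {k : ℕ} : IsUnit (k : ℤ_[p]) ↔ ¬ p ∣ k := by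
  rw [PadicInt.isUnit_iff, PadicInt.norm_natCast_eq_one_iff,
    (Fact.out : p.Prime).coprime_iff_not_dvd]

lemma natCast_dvd_iff_padicInt {k : ℕ} : (p : ℤ_[p]) ∣ (k : ℤ_[p]) ↔ p ∣ k := by
  rw [← PadicInt.norm_lt_one_iff_dvd, PadicInt.norm_natCast_lt_one_iff]

lemma natInv_of_dvd {k : ℕ} (h : p ∣ k) : natInv p k = 0 :=
  Ring.inverse_non_unit _ (by rwa [isUnit_natCast_padicInt, not_not])

lemma mul_natInv {k : ℕ} (h : ¬ p ∣ k) : (k : ℤ_[p]) * natInv p k = 1 :=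
  Ring.mul_inverse_cancel _ (isUnit_natCast_padicInt.2 h)

lemma natInv_mul (a b : ℕ) : natInv p (a * b) = natInv p a * natInv p b := by
  simp only [natInv, Nat.cast_mul]
  rw [Ring.mul_inverse_rev, mul_comm]

lemma sum_range_mul_eq_sum_blocks {M : Type*} [AddCommMonoid M] (f : ℕ → M) (L q : ℕ) :
    ∑ i ∈ Finset.range (L * q), f i =
      ∑ j ∈ Finset.range q, ∑ k ∈ Finset.range L, f (k + j * L) := by
  induction q with
  | zero => simp
  | succ q ih =>
    rw [Nat.mul_succ, Finset.sum_range_add, ih, Finset.sum_range_succ]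
    congr 1
    exact Finset.sum_congr rfl fun k _ => by rw [add_comm, mul_comm]

/-- Reflecting `k ↦ L - k` in a sum of a function vanishing at `0` and `L`. -/
lemma sum_range_reflect_of_zero {M : Type*} [AddCommMonoid M] (f : ℕ → M) (L : ℕ)
    (h0 : f 0 = 0) (hL : f L = 0) :
    ∑ k ∈ Finset.range L, f (L - k) = ∑ k ∈ Finset.range L, f k := by
  have h := Finset.sum_range_reflect f (L + 1)
  rw [Finset.sum_range_succ, Finset.sum_range_succ f] at h
  simpa [h0, hL] using h

/-- Expansion of 1/(L-k) in powers of L, with exact remainder. -/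
lemma natInv_sub {L k : ℕ} (hL : p ∣ L) (hk : k ≤ L) :
    natInv p (L - k) = -natInv p k - L * natInv p k ^ 2 +
      L ^ 2 * (natInv p k ^ 2 * natInv p (L - k)) := by
  by_cases h : p ∣ k
  · simp [natInv_of_dvd h, natInv_of_dvd (Nat.dvd_sub hL h)]
  · have h' : ¬ p ∣ L - k := fun h' => h ((Nat.dvd_sub_iff_right hk hL).1 h')
    have e1 := mul_natInv h
    have e2 := mul_natInv h'
    rw [Nat.cast_sub hk] at e2
    generalize natInv p k = a at *
    generalize natInv p (L - k) = b at *
    have e3 : (L : ℤ_[p]) * (a * b) = a + b := by linear_combination a * e2 + b * e1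
    linear_combination (-1 - L * a) * e3

/-- Since 1/(L-k) ≡ -1/k mod p, reflection makes the sum its own negative mod p. -/
lemma dvd_sum_natInv_cube (hp : p ≠ 2) {L : ℕ} (hL : p ∣ L) :
    (p : ℤ_[p]) ∣ ∑ k ∈ Finset.range L, natInv p k ^ 3 := by
  have hu : IsUnit ((2 : ℕ) : ℤ_[p]) := isUnit_natCast_padicInt.2 fun h =>
    hp ((Nat.prime_dvd_prime_iff_eq Fact.out Nat.prime_two).1 h)
  have hr := sum_range_reflect_of_zero (fun k => natInv p k ^ 3) L
    (by simp [natInv_of_dvd]) (by simp [natInv_of_dvd hL])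
  rw [← hu.dvd_mul_left, Nat.cast_two, two_mul]
  nth_rewrite 1 [← hr]
  rw [← Finset.sum_add_distrib]
  refine Finset.dvd_sum fun k hk => ?_
  have e := natInv_sub hL (Finset.mem_range.1 hk).le
  have hL' : (p : ℤ_[p]) ∣ L := natCast_dvd_iff_padicInt.2 hL
  obtain ⟨c, hc⟩ := hL'
  have : (p : ℤ_[p]) ∣ natInv p (L - k) + natInv p k :=
    ⟨c * (-natInv p k ^ 2 + L * (natInv p k ^ 2 * natInv p (L - k))), by
      linear_combination e + (-natInv p k ^ 2 + L * (natInv p k ^ 2 * natInv p (L - k))) * hc⟩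
  refine this.trans ⟨natInv p (L - k) ^ 2 - natInv p (L - k) * natInv p k + natInv p k ^ 2, ?_⟩
  ring

lemma natInv_add_sq {k y : ℕ} (hy : p ∣ y) :
    (y : ℤ_[p]) ^ 3 ∣ natInv p (k + y) ^ 2 -
      (natInv p k ^ 2 - 2 * y * natInv p k ^ 3 + 3 * y ^ 2 * natInv p k ^ 4) := by
  by_cases h : p ∣ k
  · simp [natInv_of_dvd h, natInv_of_dvd (dvd_add h hy)]
  · have h' : ¬ p ∣ k + y := fun h' => h ((Nat.dvd_add_left hy).1 h')
    have e1 := mul_natInv h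
    have e2 := mul_natInv h'
    push_cast at e2
    generalize natInv p k = a at *
    generalize natInv p (k + y) = b at *
    generalize (y : ℤ_[p]) = y at *
    have e3 : b = a - y * (a * b) := by linear_combination a * e2 - b * e1
    have e4 : b = a - y * a ^ 2 + y ^ 2 * a ^ 3 - y ^ 3 * (a ^ 3 * b) := by
      linear_combination (1 - y * a + y ^ 2 * a ^ 2) * e3
    refine ⟨-(2 * a ^ 5) + y * a ^ 6 - 2 * (a - y * a ^ 2 + y ^ 2 * a ^ 3) * (a ^ 3 * b)
      + y ^ 3 * (a ^ 3 * b) ^ 2, ?_⟩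
    linear_combination (b + (a - y * a ^ 2 + y ^ 2 * a ^ 3 - y ^ 3 * (a ^ 3 * b))) * e4

/-- Taylor expansion of 1/(k+jL)² over q blocks of length L. -/
lemma sum_natInv_sq_blocks {L : ℕ} (hL : p ∣ L) (q : ℕ) :
    (L : ℤ_[p]) ^ 3 ∣ ∑ k ∈ Finset.range (L * q), natInv p k ^ 2 -
      (q * ∑ k ∈ Finset.range L, natInv p k ^ 2
        - 2 * L * (∑ j ∈ Finset.range q, (j : ℤ_[p])) * ∑ k ∈ Finset.range L, natInv p k ^ 3
        + 3 * L ^ 2 * (∑ j ∈ Finset.range q, (j : ℤ_[p]) ^ 2) *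
          ∑ k ∈ Finset.range L, natInv p k ^ 4) := by
  have h : ∑ k ∈ Finset.range (L * q), natInv p k ^ 2 -
      (q * ∑ k ∈ Finset.range L, natInv p k ^ 2
        - 2 * L * (∑ j ∈ Finset.range q, (j : ℤ_[p])) * ∑ k ∈ Finset.range L, natInv p k ^ 3
        + 3 * L ^ 2 * (∑ j ∈ Finset.range q, (j : ℤ_[p]) ^ 2) *
          ∑ k ∈ Finset.range L, natInv p k ^ 4) =
      ∑ j ∈ Finset.range q, ∑ k ∈ Finset.range L, (natInv p (k + j * L) ^ 2 -
      (natInv p k ^ 2 - 2 * (j * L : ℕ) * natInv p k ^ 3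
        + 3 * (j * L : ℕ) ^ 2 * natInv p k ^ 4)) := by
    rw [sum_range_mul_eq_sum_blocks]
    simp only [Finset.sum_sub_distrib, Finset.sum_add_distrib, ← Finset.mul_sum, ← Finset.sum_mul,
      Finset.sum_const, Finset.card_range, nsmul_eq_mul, Nat.cast_mul, mul_pow]
    ring
  rw [h]
  refine Finset.dvd_sum fun j _ => Finset.dvd_sum fun k _ => ?_
  exact (pow_dvd_pow_of_dvd (by simp) 3).trans (natInv_add_sq (hL.mul_left j))

lemma dvd_sum_range_sq {q : ℕ} (hq : q.Prime) (h5 : 5 ≤ q) :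
    q ∣ ∑ j ∈ Finset.range q, j ^ 2 := by
  have h6 : ∀ m : ℕ, 6 * ∑ j ∈ Finset.range (m + 1), j ^ 2 = m * (m + 1) * (2 * m + 1) := by
    intro m
    induction m with
    | zero => simp
    | succ m ih => rw [Finset.sum_range_succ, mul_add, ih]; ring
  obtain ⟨m, rfl⟩ : ∃ m, q = m + 1 := ⟨q - 1, by omega⟩
  have : (m + 1) ∣ 6 * ∑ j ∈ Finset.range (m + 1), j ^ 2 :=
    h6 m ▸ ((dvd_mul_left _ _).mul_right _)
  refine (Nat.Coprime.dvd_of_dvd_mul_left ?_ this)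
  rw [hq.coprime_iff_not_dvd]
  intro h
  have hm : m ≤ 5 := by have := Nat.le_of_dvd (by norm_num) h; omega
  have hm4 : 4 ≤ m := by omega
  clear this h6 h5
  interval_cases m <;> revert hq h <;> decide

lemma sum_natInv_sq_mul_unit (hp : p ≠ 2) (u : ℕ) :
    (p : ℤ_[p]) ^ 2 ∣ ∑ k ∈ Finset.range (p * u), natInv p k ^ 2 -
      u * ∑ k ∈ Finset.range p, natInv p k ^ 2 := by
  obtain ⟨c, hc⟩ := sum_natInv_sq_blocks (dvd_refl p) u
  obtain ⟨d, hd⟩ := dvd_sum_natInv_cube hp (dvd_refl p)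
  rw [hd] at hc
  exact ⟨p * c - 2 * (∑ j ∈ Finset.range u, (j : ℤ_[p])) * d +
    3 * (∑ j ∈ Finset.range u, (j : ℤ_[p]) ^ 2) * ∑ k ∈ Finset.range p, natInv p k ^ 4,
    by linear_combination hc⟩

/-- In the block expansion, Σ j, Σ j² and Σ 1/k³ are all divisible by p, so the errors have
valuations at least r+2, 2r+1 and 3r. -/
lemma sum_natInv_sq_mul_prime (hp : 5 ≤ p) {L r : ℕ} (hr : r ≠ 0) (hL : p ^ r ∣ L) :
    (p : ℤ_[p]) ^ (r + 2) ∣ ∑ k ∈ Finset.range (L * p), natInv p k ^ 2 -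
      p * ∑ k ∈ Finset.range L, natInv p k ^ 2 := by
  have hpL : p ∣ L := (dvd_pow_self p hr).trans hL
  obtain ⟨c, hc⟩ := sum_natInv_sq_blocks hpL p
  obtain ⟨d, hd⟩ := dvd_sum_natInv_cube (by omega) hpL
  have h1 : p ∣ ∑ j ∈ Finset.range p, j := by
    have h := Finset.sum_range_id_mul_two p
    refine Nat.Coprime.dvd_of_dvd_mul_right (n := 2) ?_ (h ▸ dvd_mul_right p (p - 1))
    rw [(Fact.out : p.Prime).coprime_iff_not_dvd]
    exact fun h => by have := Nat.le_of_dvd (by norm_num) h; omega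
  obtain ⟨e, he⟩ := natCast_dvd_iff_padicInt.2 h1
  obtain ⟨f, hf⟩ := natCast_dvd_iff_padicInt.2 (dvd_sum_range_sq Fact.out hp)
  obtain ⟨l, rfl⟩ := hL
  push_cast at he hf hc
  rw [hd, he, hf] at hc
  obtain ⟨s, rfl⟩ := Nat.exists_eq_add_one_of_ne_zero hr
  refine ⟨(p ^ s) ^ 2 * l ^ 3 * c - 2 * l * e * d + 3 * p ^ s * l ^ 2 * f *
    ∑ k ∈ Finset.range (p ^ (s + 1) * l), natInv p k ^ 4, ?_⟩
  simp only [pow_succ] at hc ⊢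
  linear_combination hc

lemma sum_natInv_sq_congr (hp : 5 ≤ p) (s u : ℕ) :
    (p : ℤ_[p]) ^ (s + 2) ∣ ∑ k ∈ Finset.range (p ^ (s + 1) * u), natInv p k ^ 2 -
      p ^ s * u * ∑ k ∈ Finset.range p, natInv p k ^ 2 := by
  induction s with
  | zero => simpa using sum_natInv_sq_mul_unit (by omega) u
  | succ s ih =>
    have h := sum_natInv_sq_mul_prime hp s.succ_ne_zero (dvd_mul_right (p ^ (s + 1)) u)
    rw [show p ^ (s + 1) * u * p = p ^ (s + 1 + 1) * u by ring] at h
    have h2 := mul_dvd_mul_left (p : ℤ_[p]) ih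
    rw [← pow_succ'] at h2
    convert dvd_add h h2 using 1
    ring

lemma two_mul_sum_natInv (hp : p ≠ 2) {L r : ℕ} (hr : r ≠ 0) (hL : p ^ r ∣ L) :
    ∃ c : ℤ_[p], 2 * ∑ k ∈ Finset.range L, natInv p k =
      L * (p ^ (r + 1) * c - ∑ k ∈ Finset.range L, natInv p k ^ 2) := by
  have hpL : p ∣ L := (dvd_pow_self p hr).trans hL
  have hrefl := sum_range_reflect_of_zero (natInv p) L
    (by simp [natInv_of_dvd]) (natInv_of_dvd hpL)
  have hsum : 2 * ∑ k ∈ Finset.range L, natInv p k =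
      L * (- ∑ k ∈ Finset.range L, natInv p k ^ 2 +
        L * ∑ k ∈ Finset.range L, natInv p k ^ 2 * natInv p (L - k)) := by
    have := Finset.sum_congr rfl fun k hk => natInv_sub hpL (Finset.mem_range.1 hk).le
    rw [hrefl] at this
    simp only [Finset.sum_add_distrib, Finset.sum_sub_distrib, Finset.sum_neg_distrib,
      ← Finset.mul_sum] at this
    linear_combination this
  obtain ⟨d, hd⟩ := dvd_sum_natInv_cube hp hpL
  -- Expanding 1/(L-k) once more turns the remainder into -Σ 1/k³ mod L, which gains the extra
  -- factor p.
  have hcub : ∑ k ∈ Finset.range L, natInv p k ^ 2 * natInv p (L - k) =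
      - (p * d) + L * ∑ k ∈ Finset.range L, (- natInv p k ^ 4 +
        L * (natInv p k ^ 4 * natInv p (L - k))) := by
    rw [← hd, Finset.mul_sum, ← Finset.sum_neg_distrib, ← Finset.sum_add_distrib]
    refine Finset.sum_congr rfl fun k hk => ?_
    linear_combination natInv p k ^ 2 * natInv_sub hpL (Finset.mem_range.1 hk).le
  obtain ⟨l, rfl⟩ := hL
  obtain ⟨s, rfl⟩ := Nat.exists_eq_add_one_of_ne_zero hr
  rw [hsum, hcub]
  generalize ∑ k ∈ Finset.range (p ^ (s + 1) * l), (- natInv p k ^ 4 +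
        ((p ^ (s + 1) * l : ℕ) : ℤ_[p]) * (natInv p k ^ 4 * natInv p (p ^ (s + 1) * l - k))) = z
  refine ⟨- l * d + p ^ s * l ^ 2 * z, ?_⟩
  push_cast
  ring

end InverseSums

/-! ### The sum of inverse squares modulo `p ^ 2` and Bernoulli numbers -/

section BernoulliCongruence

variable {p : ℕ} [Fact p.Prime]

lemma sum_range_two_mul_mod {M : Type*} [AddCommMonoid M] (hp : p ≠ 2) (f : ℕ → M) :
    ∑ k ∈ Finset.range p, f (2 * k % p) = ∑ k ∈ Finset.range p, f k := by
  have hp0 : 0 < p := (Fact.out : p.Prime).pos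
  have hmap : Set.MapsTo (fun k => 2 * k % p) (Finset.range p) (Finset.range p) := fun k _ => by
    simpa using Nat.mod_lt _ hp0
  have hinj : Set.InjOn (fun k => 2 * k % p) (Finset.range p) := by
    intro a ha b hb hab
    have hcop : Nat.gcd p 2 = 1 :=
      (Nat.coprime_primes Fact.out Nat.prime_two).2 hp
    have : a ≡ b [MOD p] := Nat.ModEq.cancel_left_of_coprime hcop hab
    exact this.eq_of_lt_of_lt (by simpa using ha) (by simpa using hb)
  exact Finset.sum_bij (fun k _ => 2 * k % p) (fun k hk => hmap hk)
    (fun a ha b hb h => hinj ha hb h)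
    (fun b hb => by
      obtain ⟨a, ha, h⟩ := Finset.surjOn_of_injOn_of_card_le _ hmap hinj le_rfl hb
      exact ⟨a, ha, h⟩) (fun _ _ => rfl)

lemma natInv_two_mul_mod_sq (k : ℕ) :
    (p : ℤ_[p]) ^ 2 ∣ natInv p (2 * k % p) ^ 2 - (natInv p (2 * k) ^ 2 +
      2 * (p * (2 * k / p : ℕ)) * natInv p (2 * k) ^ 3) := by
  have hdm := Nat.mod_add_div (2 * k) p
  generalize 2 * k % p = m at *
  generalize 2 * k / p = e at *
  generalize 2 * k = t at *
  subst hdm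
  by_cases h : p ∣ m
  · simp [natInv_of_dvd h, natInv_of_dvd (dvd_add h (dvd_mul_right p e))]
  · have h' : ¬ p ∣ m + p * e := fun h' => h ((Nat.dvd_add_left (dvd_mul_right p e)).1 h')
    have e1 := mul_natInv h
    have e2 := mul_natInv h'
    push_cast at e2
    generalize natInv p m = a at *
    generalize natInv p (m + p * e) = b at *
    have e3 : a = b + p * e * b * a := by linear_combination b * e1 - a * e2
    have e4 : a = b + p * e * b ^ 2 + (p * e) ^ 2 * b ^ 2 * a := by
      linear_combination (1 + p * e * b) * e3
    refine ⟨e ^ 2 * (b ^ 4 + 2 * (b + p * e * b ^ 2) * b ^ 2 * a +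
      (p * e) ^ 2 * (b ^ 2 * a) ^ 2), ?_⟩
    linear_combination (a + (b + p * e * b ^ 2 + (p * e) ^ 2 * b ^ 2 * a)) * e4

lemma two_mul_mod_pow_succ (k m : ℕ) :
    (p : ℤ_[p]) ^ 2 ∣ ((2 * k % p : ℕ) : ℤ_[p]) ^ (m + 1) - ((2 * k) ^ (m + 1) -
      (m + 1) * (p * (2 * k / p : ℕ)) * (2 * k) ^ m) := by
  have hdm := congrArg (Nat.cast : ℕ → ℤ_[p]) (Nat.mod_add_div (2 * k) p)
  push_cast at hdm
  have h : ((2 * k % p : ℕ) : ℤ_[p]) = 2 * k + -(p * (2 * k / p : ℕ)) := by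
    linear_combination hdm
  rw [h]
  obtain ⟨c, hc⟩ := (Polynomial.powAddExpansion (2 * (k : ℤ_[p])) (-(p * (2 * k / p : ℕ))) (m + 1))
  rw [hc]
  refine ⟨c * (2 * k / p : ℕ) ^ 2, ?_⟩
  push_cast [Nat.add_sub_cancel]
  ring

lemma natCast_pow_mul_natInv_pow {k : ℕ} (hk : ¬ p ∣ k) (a b : ℕ) :
    (k : ℤ_[p]) ^ (a + b) * natInv p k ^ b = (k : ℤ_[p]) ^ a := by
  rw [pow_add, mul_assoc, ← mul_pow, mul_natInv hk, one_pow, mul_one]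

lemma natCast_pow_sub_natInv_pow {k a b : ℕ} (hk : ¬ p ∣ k) (hab : a + b = p - 1) :
    (p : ℤ_[p]) ∣ (k : ℤ_[p]) ^ a - natInv p k ^ b := by
  have h1 : (p : ℤ_[p]) ∣ (k : ℤ_[p]) ^ (p - 1) - 1 := by
    have hcop : IsCoprime (k : ℤ) (p : ℤ) := by
      rw [Int.isCoprime_iff_gcd_eq_one, Int.gcd_natCast_natCast]
      exact ((Fact.out : p.Prime).coprime_iff_not_dvd.2 hk).symm
    have := (Int.ModEq.pow_card_sub_one_eq_one Fact.out hcop).symm.dvd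
    have h2 := (PadicInt.pow_p_dvd_int_iff (p := p) 1 ((k : ℤ) ^ (p - 1) - 1)).2 (by simpa using this)
    simpa using h2
  rw [← hab] at h1
  have h3 := h1.mul_right (natInv p k ^ b)
  rwa [sub_mul, natCast_pow_mul_natInv_pow hk, one_mul] at h3

/-- A special case of Kummer's congruence, in terms of power sums. -/
lemma three_mul_sum_natInv_sq_sub (hp : 5 ≤ p) :
    (p : ℤ_[p]) ^ 2 ∣ 3 * ∑ k ∈ Finset.range p, natInv p k ^ 2 -
      2 * ∑ k ∈ Finset.range p, (k : ℤ_[p]) ^ (p - 3) := by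
  have hpp : p.Prime := Fact.out
  have hsmall : ∀ {a : ℕ}, 0 < a → a < p → ¬ p ∣ a := fun h0 hlt =>
    Nat.not_dvd_of_pos_of_lt h0 hlt
  have h3u : IsUnit ((3 : ℕ) : ℤ_[p]) := isUnit_natCast_padicInt.2 (hsmall (by norm_num) (by omega))
  have h2 : ¬ p ∣ 2 := hsmall (by norm_num) (by omega)
  set h := natInv p 2 with hh
  have e2h : 2 * h = 1 := by simpa using mul_natInv h2
  set F := ∑ k ∈ Finset.range p, natInv p k ^ 2 with hF
  set P := ∑ k ∈ Finset.range p, (k : ℤ_[p]) ^ (p - 3) with hP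
  set W := ∑ k ∈ Finset.range p, ((2 * k / p : ℕ) : ℤ_[p]) * natInv p k ^ 3 with hW
  set V := ∑ k ∈ Finset.range p, ((2 * k / p : ℕ) : ℤ_[p]) * (k : ℤ_[p]) ^ (p - 4) with hV
  have hVW : (p : ℤ_[p]) ∣ V - W := by
    rw [hV, hW, ← Finset.sum_sub_distrib]
    refine Finset.dvd_sum fun k hk => ?_
    rw [← mul_sub]
    rcases Nat.eq_zero_or_pos k with rfl | hk0
    · simp
    · exact (natCast_pow_sub_natInv_pow (hsmall hk0 (Finset.mem_range.1 hk)) (by omega)).mul_left _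
  have hPF : (p : ℤ_[p]) ∣ P - F := by
    rw [hP, hF, ← Finset.sum_sub_distrib]
    refine Finset.dvd_sum fun k hk => ?_
    rcases Nat.eq_zero_or_pos k with rfl | hk0
    · simp [natInv_of_dvd, show p - 3 ≠ 0 by omega]
    · exact natCast_pow_sub_natInv_pow (hsmall hk0 (Finset.mem_range.1 hk)) (by omega)
  -- Doubling permutes the residues mod p. Expanding 2k % p = 2k - p⌊2k/p⌋ to first order, for both
  -- F and P, yields two relations with the same W mod p.
  have hF1 : (p : ℤ_[p]) ^ 2 ∣ F - (h ^ 2 * F + 2 * p * h ^ 3 * W) := by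
    have : F - (h ^ 2 * F + 2 * p * h ^ 3 * W) = ∑ k ∈ Finset.range p,
        (natInv p (2 * k % p) ^ 2 - (natInv p (2 * k) ^ 2 +
          2 * (p * (2 * k / p : ℕ)) * natInv p (2 * k) ^ 3)) := by
      rw [Finset.sum_sub_distrib, sum_range_two_mul_mod (by omega) (fun k => natInv p k ^ 2),
        Finset.sum_add_distrib, hF, hW, Finset.mul_sum, Finset.mul_sum]
      congr 2 <;> refine Finset.sum_congr rfl fun k _ => ?_ <;> rw [natInv_mul, ← hh] <;> ring
    rw [this]
    exact Finset.dvd_sum fun k _ => natInv_two_mul_mod_sq k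
  have hP1 : (p : ℤ_[p]) ^ 2 ∣ P - (2 ^ (p - 3) * P - (p - 3) * p * 2 ^ (p - 4) * V) := by
    have hp3 : p - 3 = p - 4 + 1 := by omega
    have hc : ((p - 4 : ℕ) : ℤ_[p]) + 1 = p - 3 := by
      rw [Nat.cast_sub (by omega)]; push_cast; ring
    have : P - (2 ^ (p - 3) * P - (p - 3) * p * 2 ^ (p - 4) * V) = ∑ k ∈ Finset.range p,
        (((2 * k % p : ℕ) : ℤ_[p]) ^ (p - 4 + 1) - ((2 * k) ^ (p - 4 + 1) -
        ((p - 4 : ℕ) + 1) * (p * (2 * k / p : ℕ)) * (2 * k) ^ (p - 4))) := by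
      rw [Finset.sum_sub_distrib,
        sum_range_two_mul_mod (by omega) (fun k => (k : ℤ_[p]) ^ (p - 4 + 1)),
        Finset.sum_sub_distrib, hP, hV, Finset.mul_sum, Finset.mul_sum, hc, ← hp3]
      congr 2 <;> refine Finset.sum_congr rfl fun k _ => ?_
      · rw [mul_pow]
      · rw [mul_pow]
        ring
    rw [this]
    exact Finset.dvd_sum fun k _ => two_mul_mod_pow_succ k (p - 4)
  obtain ⟨x, hx⟩ := natCast_pow_sub_natInv_pow (p := p) (a := p - 3) (b := 2) h2 (by omega)
  obtain ⟨y, hy⟩ := natCast_pow_sub_natInv_pow (p := p) (a := p - 4) (b := 3) h2 (by omega)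
  rw [← hh] at hx hy
  push_cast at hx hy
  obtain ⟨v, hv⟩ := hVW
  obtain ⟨f, hf⟩ := hF1
  obtain ⟨w, hw⟩ := hP1
  have hpF : (p : ℤ_[p]) ∣ F := by
    rw [← h3u.dvd_mul_left]
    push_cast
    exact ⟨4 * p * f + 8 * h ^ 3 * W, by linear_combination 4 * hf + F * (2 * h + 1) * e2h⟩
  have hpP : (p : ℤ_[p]) ∣ P := (dvd_sub_left hpF).1 hPF
  obtain ⟨q, hq⟩ := hpP
  rw [← h3u.dvd_mul_left]
  push_cast
  have hx' : (2 : ℤ_[p]) ^ (p - 3) = h ^ 2 + p * x := by linear_combination hx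
  have hy' : (2 : ℤ_[p]) ^ (p - 4) = h ^ 3 + p * y := by linear_combination hy
  have hv' : V = W + p * v := by linear_combination hv
  have hw' : P * (1 - h ^ 2) - 3 * p * h ^ 3 * W = p ^ 2 * (w + x * q - (h ^ 3 + p * y) * V
      + 3 * y * V + 3 * h ^ 3 * v) := by
    rw [hx', hy'] at hw
    linear_combination hw + p * x * hq + 3 * p * h ^ 3 * hv'
  -- Eliminating W leaves (1-h²)(3F-2P) ≡ 0 mod p², and 4(1-h²) = 3 since 2h = 1.
  exact ⟨12 * f - 8 * (w + x * q - (h ^ 3 + p * y) * V + 3 * y * V + 3 * h ^ 3 * v), by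
    linear_combination 12 * hf - 8 * hw' + (3 * F - 2 * P) * (2 * h + 1) * e2h⟩

/-- The Bernoulli recursion divides only by i+1, a p-adic unit in this range. -/
lemma norm_bernoulli_le_one {i : ℕ} (hi : i + 1 < p) : ‖((bernoulli i : ℚ) : ℚ_[p])‖ ≤ 1 := by
  induction i using Nat.strong_induction_on with
  | _ i ih =>
    have hs := sum_bernoulli (i + 1)
    rw [Finset.sum_range_succ] at hs
    have hu : ‖((i + 1 : ℕ) : ℚ_[p])‖ = 1 := by
      rw [Padic.norm_natCast_eq_one_iff, (Fact.out : p.Prime).coprime_iff_not_dvd]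
      exact Nat.not_dvd_of_pos_of_lt (by omega) hi
    have hs' : ((i + 1 : ℕ) : ℚ_[p]) * ((bernoulli i : ℚ) : ℚ_[p]) =
        ((if i + 1 = 1 then 1 else 0 : ℕ) : ℚ_[p]) -
        ∑ k ∈ Finset.range i, ((i + 1).choose k : ℚ_[p]) * ((bernoulli k : ℚ) : ℚ_[p]) := by
      rw [eq_sub_iff_add_eq, add_comm]
      have := congrArg (Rat.cast : ℚ → ℚ_[p]) hs
      rw [Nat.cast_ite]
      push_cast at this ⊢
      simpa [apply_ite (Rat.cast : ℚ → ℚ_[p])] using this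
    have hn : ‖((i + 1 : ℕ) : ℚ_[p]) * ((bernoulli i : ℚ) : ℚ_[p])‖ ≤ 1 := by
      rw [hs', ← PadicInt.mem_subring_iff]
      refine sub_mem (natCast_mem _ _) (sum_mem fun k hk => mul_mem (natCast_mem _ _) ?_)
      rw [PadicInt.mem_subring_iff]
      have := Finset.mem_range.1 hk
      exact ih k this (by omega)
    rwa [norm_mul, hu, one_mul] at hn

/-- In Faulhaber's formula, the terms with index below p-3 carry at least p²; in the top one the
binomial p-2 cancels the denominator. -/
lemma sum_pow_sub_three_congr (hp : 5 ≤ p) :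
    ∃ b c : ℤ_[p], (b : ℚ_[p]) = (bernoulli (p - 3) : ℚ) ∧
      ∑ k ∈ Finset.range p, (k : ℤ_[p]) ^ (p - 3) = p * b + p ^ 2 * c := by
  have hb : ∀ i : ℕ, ∃ b : ℤ_[p], i ∈ Finset.range (p - 2) →
      (b : ℚ_[p]) = (bernoulli i : ℚ) := by
    intro i
    by_cases hi : i < p - 2
    · exact ⟨⟨_, norm_bernoulli_le_one (p := p) (i := i) (by omega)⟩, fun _ => rfl⟩
    · exact ⟨0, fun h => absurd (Finset.mem_range.1 h) hi⟩
  choose b hb using hb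
  have h2 : ¬ p ∣ p - 2 := Nat.not_dvd_of_pos_of_lt (by omega) (by omega)
  have h2' := mul_natInv (p := p) h2
  have h20 : ((p - 2 : ℕ) : ℚ_[p]) ≠ 0 := by
    rw [Nat.cast_ne_zero]; omega
  refine ⟨b (p - 3), natInv p (p - 2) * ∑ i ∈ Finset.range (p - 3),
    b i * (p - 2).choose i * p ^ (p - 4 - i), hb _ (by simp; omega), ?_⟩
  have hP : ((p - 2 : ℕ) : ℤ_[p]) * ∑ k ∈ Finset.range p, (k : ℤ_[p]) ^ (p - 3) =
      ∑ i ∈ Finset.range (p - 2), b i * (p - 2).choose i * p ^ (p - 2 - i) := by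
    refine PadicInt.ext ?_
    rw [PadicInt.coe_mul, PadicInt.coe_sum, PadicInt.coe_sum]
    have hs := congrArg (Rat.cast : ℚ → ℚ_[p]) (sum_range_pow p (p - 3))
    rw [show p - 3 + 1 = p - 2 by omega, ← Finset.sum_div] at hs
    push_cast at hs ⊢
    have hc3 : ((p - 3 : ℕ) : ℚ_[p]) + 1 = ((p - 2 : ℕ) : ℚ_[p]) := by
      rw [← Nat.cast_add_one, show p - 3 + 1 = p - 2 by omega]
    rw [hs, hc3, mul_div_cancel₀ _ h20]
    exact Finset.sum_congr rfl fun i hi => by rw [hb i hi]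
  rw [show p - 2 = p - 3 + 1 by omega, Finset.sum_range_succ,
    show p - 3 + 1 = p - 2 by omega] at hP
  have hch : (p - 2).choose (p - 3) = p - 2 := by
    rw [show p - 2 = p - 3 + 1 by omega, Nat.choose_succ_self_right]
  have hlow : ∑ i ∈ Finset.range (p - 3), b i * (p - 2).choose i * (p : ℤ_[p]) ^ (p - 2 - i) =
      p ^ 2 * ∑ i ∈ Finset.range (p - 3), b i * (p - 2).choose i * p ^ (p - 4 - i) := by
    rw [Finset.mul_sum]
    refine Finset.sum_congr rfl fun i hi => ?_
    have := Finset.mem_range.1 hi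
    rw [show p - 2 - i = 2 + (p - 4 - i) by omega, pow_add]
    ring
  rw [hlow, hch, show p - 2 - (p - 3) = 1 by omega, pow_one] at hP
  linear_combination natInv p (p - 2) * hP +
    (p * b (p - 3) - ∑ k ∈ Finset.range p, (k : ℤ_[p]) ^ (p - 3)) * h2'

lemma not_sq_dvd_sum_natInv_sq (hp : 5 ≤ p) (hB : ¬ (p : ℤ) ∣ (bernoulli (p - 3)).num) :
    ¬ (p : ℤ_[p]) ^ 2 ∣ ∑ k ∈ Finset.range p, natInv p k ^ 2 := by
  intro h
  obtain ⟨b, c, hb, hP⟩ := sum_pow_sub_three_congr hp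
  have h1 := (dvd_sub_right (h.mul_left 3)).1 (three_mul_sum_natInv_sq_sub hp)
  have h2u : IsUnit ((2 : ℕ) : ℤ_[p]) :=
    isUnit_natCast_padicInt.2 (Nat.not_dvd_of_pos_of_lt (by norm_num) (by omega))
  rw [← Nat.cast_two (R := ℤ_[p]), h2u.dvd_mul_left, hP,
    dvd_add_left (dvd_mul_right _ _), pow_two,
    mul_dvd_mul_iff_left PadicInt.prime_p.ne_zero] at h1
  apply hB
  rw [← PadicInt.norm_int_lt_one_iff_dvd (p := p), PadicInt.norm_lt_one_iff_dvd]
  have : (((bernoulli (p - 3)).num : ℤ) : ℤ_[p]) = b * ((bernoulli (p - 3)).den : ℤ_[p]) := by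
    apply PadicInt.ext
    push_cast
    rw [hb]
    exact_mod_cast congrArg (Rat.cast : ℚ → ℚ_[p]) (Rat.mul_den_eq_num (bernoulli (p - 3))).symm
  rw [this]
  exact h1.mul_right _

end BernoulliCongruence

/-! ### Valuations of harmonic numbers -/

section Harmonic

variable {p : ℕ} [Fact p.Prime]

lemma isUnit_padicInt_iff_not_dvd {x : ℤ_[p]} : IsUnit x ↔ ¬ (p : ℤ_[p]) ∣ x := by
  rw [← PadicInt.norm_lt_one_iff_dvd, ← PadicInt.not_isUnit_iff, not_not]

lemma valuation_eq_zero_of_isUnit {x : ℤ_[p]} (hx : IsUnit x) : x.valuation = 0 := by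
  obtain ⟨y, hy⟩ := hx.exists_right_inv
  have h := congrArg PadicInt.valuation hy
  rw [PadicInt.valuation_mul hx.ne_zero (right_ne_zero_of_mul_eq_one hy),
    PadicInt.valuation_one] at h
  omega

lemma dvd_sum_natInv_sq (hp : 5 ≤ p) :
    (p : ℤ_[p]) ∣ ∑ k ∈ Finset.range p, natInv p k ^ 2 := by
  obtain ⟨b, c, -, hP⟩ := sum_pow_sub_three_congr hp
  obtain ⟨d, hd⟩ := three_mul_sum_natInv_sq_sub hp
  have h3u : IsUnit ((3 : ℕ) : ℤ_[p]) :=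
    isUnit_natCast_padicInt.2 (Nat.not_dvd_of_pos_of_lt (by norm_num) (by omega))
  rw [← h3u.dvd_mul_left]
  exact ⟨p * d + 2 * (b + p * c), by push_cast; linear_combination hd + 2 * hP⟩

/-- Of the exponent 2s+2, one s+1 comes from the factor L, the other from Σ 1/k². -/
lemma sum_natInv_eq_pow_mul_unit (hp : 5 ≤ p) (hB : ¬ (p : ℤ) ∣ (bernoulli (p - 3)).num)
    (s : ℕ) {u : ℕ} (hu : ¬ p ∣ u) :
    ∃ w : ℤ_[p], IsUnit w ∧
      ∑ k ∈ Finset.range (p ^ (s + 1) * u), natInv p k = p ^ (2 * s + 2) * w := by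
  obtain ⟨f, hf⟩ := dvd_sum_natInv_sq hp
  have hfp : ¬ (p : ℤ_[p]) ∣ f := by
    rintro ⟨g, rfl⟩
    exact not_sq_dvd_sum_natInv_sq hp hB ⟨g, by rw [hf]; ring⟩
  obtain ⟨d, hd⟩ := sum_natInv_sq_congr hp s u
  obtain ⟨c, hc⟩ := two_mul_sum_natInv (p := p) (by omega) s.succ_ne_zero
    (dvd_mul_right (p ^ (s + 1)) u)
  have h2 : ¬ p ∣ 2 := Nat.not_dvd_of_pos_of_lt (by norm_num) (by omega)
  have h2h : 2 * natInv p 2 = 1 := by simpa using mul_natInv h2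
  refine ⟨natInv p 2 * (u * (p * (c - d) - u * f)), ?_, ?_⟩
  · refine (IsUnit.of_mul_eq_one_right _ h2h).mul ((isUnit_natCast_padicInt.2 hu).mul ?_)
    rw [isUnit_padicInt_iff_not_dvd, dvd_sub_right (dvd_mul_right _ _),
      (isUnit_natCast_padicInt.2 hu).dvd_mul_left]
    exact hfp
  · rw [hf] at hd
    push_cast [pow_succ] at hc hd ⊢
    rw [mul_comm 2 s, pow_mul]
    linear_combination natInv p 2 * hc - natInv p 2 * p ^ s * p * u * hd -
      (∑ k ∈ Finset.range (p ^ s * p * u), natInv p k) * h2h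

/-- The sum of `1 / k` over `k < p * N` prime to `p`. -/
def coprimeHarmonic (p N : ℕ) : ℚ :=
  ∑ k ∈ Finset.range (p * N), if p ∣ k then 0 else (k : ℚ)⁻¹

lemma coprimeHarmonic_cast (N : ℕ) :
    ((coprimeHarmonic p N : ℚ) : ℚ_[p]) =
      ((∑ k ∈ Finset.range (p * N), natInv p k : ℤ_[p]) : ℚ_[p]) := by
  rw [coprimeHarmonic, PadicInt.coe_sum, Rat.cast_sum]
  refine Finset.sum_congr rfl fun k _ => ?_
  by_cases h : p ∣ k
  · simp [h, natInv_of_dvd h]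
  · have e := congrArg (fun x : ℤ_[p] => (x : ℚ_[p])) (mul_natInv h)
    simp only [PadicInt.coe_mul, PadicInt.coe_natCast, PadicInt.coe_one] at e
    rw [if_neg h, Rat.cast_inv, Rat.cast_natCast]
    exact inv_eq_of_mul_eq_one_right e

lemma coprimeHarmonic_valuation (hp : 5 ≤ p) (hB : ¬ (p : ℤ) ∣ (bernoulli (p - 3)).num)
    (s : ℕ) {u : ℕ} (hu : ¬ p ∣ u) :
    coprimeHarmonic p (p ^ s * u) ≠ 0 ∧
      padicValRat p (coprimeHarmonic p (p ^ s * u)) = 2 * s + 2 := by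
  obtain ⟨w, hw, h⟩ := sum_natInv_eq_pow_mul_unit hp hB s hu
  have hc := coprimeHarmonic_cast (p := p) (p ^ s * u)
  rw [show p * (p ^ s * u) = p ^ (s + 1) * u by ring, h] at hc
  constructor
  · intro h0
    rw [h0, Rat.cast_zero, eq_comm, PadicInt.coe_eq_zero] at hc
    exact mul_ne_zero (pow_ne_zero _ PadicInt.prime_p.ne_zero) hw.ne_zero hc
  · rw [← Padic.valuation_ratCast, hc, PadicInt.valuation_coe,
      PadicInt.valuation_p_pow_mul _ _ hw.ne_zero, valuation_eq_zero_of_isUnit hw]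
    push_cast
    ring

lemma harmonic_eq_sum_range_succ (n : ℕ) :
    harmonic n = ∑ k ∈ Finset.range (n + 1), (k : ℚ)⁻¹ := by
  rw [Finset.sum_range_succ']
  simp [harmonic]

lemma harmonic_prime_mul (N : ℕ) :
    harmonic (p * N) = (p : ℚ)⁻¹ * harmonic N + coprimeHarmonic p N := by
  have hp0 : 0 < p := (Fact.out : p.Prime).pos
  have h : ∑ k ∈ Finset.range (p * N), (k : ℚ)⁻¹ =
      (p : ℚ)⁻¹ * ∑ k ∈ Finset.range N, (k : ℚ)⁻¹ + coprimeHarmonic p N := by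
    rw [coprimeHarmonic, sum_range_mul_eq_sum_blocks, sum_range_mul_eq_sum_blocks, Finset.mul_sum,
      ← Finset.sum_add_distrib]
    refine Finset.sum_congr rfl fun j _ => ?_
    rw [← Finset.add_sum_erase _ _ (Finset.mem_range.2 hp0),
      ← Finset.add_sum_erase (Finset.range p) _ (Finset.mem_range.2 hp0)]
    simp only [zero_add, dvd_mul_left, if_true, Nat.cast_mul, mul_inv]
    rw [mul_comm]
    congr 1
    refine Finset.sum_congr rfl fun k hk => ?_
    rw [Finset.mem_erase, Finset.mem_range] at hk
    rw [if_neg]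
    rw [Nat.dvd_add_left (dvd_mul_left p j)]
    exact Nat.not_dvd_of_pos_of_lt (Nat.pos_of_ne_zero hk.1) hk.2
  rw [harmonic_eq_sum_range_succ, harmonic_eq_sum_range_succ, Finset.sum_range_succ,
    Finset.sum_range_succ, h]
  push_cast
  rw [mul_inv]
  ring

/-- With `t m = m + ν_p(H(p ^ m n))`, the step from `t m` to `t (m + 1)` adds a term of
valuation `3 m + 3`. -/
lemma nuH_step (hp : 5 ≤ p) (hB : ¬ (p : ℤ) ∣ (bernoulli (p - 3)).num)
    {n : ℕ} (hn : ¬ p ∣ n) (m : ℕ) :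
    (m + nuH p (p ^ m * n) < 3 * m + 3 →
      (m + 1 : ℕ) + nuH p (p ^ (m + 1) * n) = m + nuH p (p ^ m * n)) ∧
    (3 * m + 3 < m + nuH p (p ^ m * n) →
      (m + 1 : ℕ) + nuH p (p ^ (m + 1) * n) = 3 * m + 3) ∧
    (m + nuH p (p ^ m * n) = 3 * m + 3 →
      3 * m + 3 ≤ (m + 1 : ℕ) + nuH p (p ^ (m + 1) * n)) := by
  have hp0 : p ≠ 0 := (Fact.out : p.Prime).ne_zero
  have hn0 : n ≠ 0 := by rintro rfl; simp at hn
  have hpQ : (p : ℚ) ≠ 0 := Nat.cast_ne_zero.2 hp0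
  have hH : ∀ j, harmonic (p ^ j * n) ≠ 0 := fun j =>
    (harmonic_pos (mul_ne_zero (pow_ne_zero _ hp0) hn0)).ne'
  obtain ⟨hS0, hSv⟩ := coprimeHarmonic_valuation hp hB m hn
  have hrec := harmonic_prime_mul (p := p) (p ^ m * n)
  rw [show p * (p ^ m * n) = p ^ (m + 1) * n by ring] at hrec
  have hq0 : (p : ℚ)⁻¹ * harmonic (p ^ m * n) ≠ 0 := mul_ne_zero (inv_ne_zero hpQ) (hH m)
  have hqv : padicValRat p ((p : ℚ)⁻¹ * harmonic (p ^ m * n)) = nuH p (p ^ m * n) - 1 := by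
    rw [padicValRat.mul (inv_ne_zero hpQ) (hH m), padicValRat.inv,
      padicValRat.self (Fact.out : p.Prime).one_lt, nuH]
    ring
  have hsum := hH (m + 1)
  have hnu : nuH p (p ^ (m + 1) * n) = padicValRat p (harmonic (p ^ (m + 1) * n)) := rfl
  rw [hrec] at hnu hsum
  refine ⟨fun h => ?_, fun h => ?_, fun h => ?_⟩
  · rw [hnu, padicValRat.add_eq_of_lt hsum hq0 hS0 (by rw [hqv, hSv]; linarith), hqv]
    push_cast
    ring
  · rw [add_comm (_⁻¹ * _)] at hnu hsum
    rw [hnu, padicValRat.add_eq_of_lt hsum hS0 hq0 (by rw [hqv, hSv]; linarith), hSv]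
    push_cast
    ring
  · have := padicValRat.le_padicValRat_add_of_le (p := p) hsum (by rw [hqv, hSv]; linarith)
    rw [hqv, ← hnu] at this
    push_cast
    linarith

end Harmonic

/-! ### The dynamics of the valuations -/

section Dynamics

variable {t : ℕ → ℤ}

lemma eq_of_lt_of_step (hlt : ∀ m : ℕ, t m < 3 * m + 3 → t (m + 1) = t m) {m₀ : ℕ}
    (h : t m₀ < 3 * m₀ + 3) {m : ℕ} (hm : m₀ ≤ m) : t m = t m₀ := by
  induction m, hm using Nat.le_induction with
  | base => rfl
  | succ m hm ih =>
    rw [← ih]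
    exact hlt m (by omega)

/-- A value above the threshold drops to 3m+3, already below the next threshold 3m+6. -/
lemma eq_of_not_lt_of_step (hgt : ∀ m : ℕ, 3 * m + 3 < t m → t (m + 1) = 3 * m + 3) {m : ℕ}
    (h : ¬ t m < 3 * m + 3) (h' : ¬ t (m + 1) < 3 * (m + 1 : ℕ) + 3) : t m = 3 * m + 3 := by
  rcases lt_trichotomy (t m) (3 * m + 3) with h1 | h1 | h1
  · exact absurd h1 h
  · exact h1
  · have := hgt m h1
    omega

lemma exists_limit_of_step (hlt : ∀ m : ℕ, t m < 3 * m + 3 → t (m + 1) = t m)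
    (hgt : ∀ m : ℕ, 3 * m + 3 < t m → t (m + 1) = 3 * m + 3)
    (heq : ∀ m : ℕ, t m = 3 * m + 3 → 3 * m + 3 ≤ t (m + 1))
    (h0 : 3 ≤ t 0) (hex : ∃ m : ℕ, t m < 3 * m + 3) :
    ∃ M : ℕ, t M = M ∧ ∀ m : ℕ, (3 * m + 3 < M → t m = 3 * m + 3) ∧
      (3 * m + 3 = M → 3 * m + 3 ≤ t m) ∧ (M < 3 * m + 3 → t m = M) := by
  classical
  -- At the first time k+1 below the threshold, t freezes at M with 3k+3 ≤ M < 3k+6. Thus M/3 - 1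
  -- lies in [k, k+1), which separates the three cases.
  set m₀ := Nat.find hex with hm₀
  have hlo : t m₀ < 3 * m₀ + 3 := Nat.find_spec hex
  have hmin : ∀ {m : ℕ}, m < m₀ → ¬ t m < 3 * m + 3 := fun h => Nat.find_min hex h
  clear_value m₀
  obtain ⟨k, rfl⟩ : ∃ k, m₀ = k + 1 := by
    refine Nat.exists_eq_add_one_of_ne_zero ?_
    rintro rfl
    simp at hlo
    omega
  have hk := hmin (Nat.lt_succ_self k)
  have hge : 3 * (k : ℤ) + 3 ≤ t (k + 1) := by
    rcases (not_lt.1 hk).lt_or_eq with h | h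
    · exact (hgt k h).ge
    · exact heq k h.symm
  obtain ⟨M, hM⟩ := Int.eq_ofNat_of_zero_le (a := t (k + 1)) (by omega)
  have hstab : ∀ {m : ℕ}, k + 1 ≤ m → t m = M := fun h => hM ▸ eq_of_lt_of_step hlt hlo h
  refine ⟨M, hstab (by omega), fun m => ⟨fun h => ?_, fun h => ?_, fun h => ?_⟩⟩
  · rcases Nat.lt_or_ge m k with hmk | hmk
    · exact eq_of_not_lt_of_step hgt (hmin (by omega)) (hmin (by omega))
    · obtain rfl : m = k := by push_cast at hlo; omega
      rcases (not_lt.1 hk).lt_or_eq with h1 | h1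
      · have := hgt m h1
        omega
      · exact h1.symm
  · exact not_lt.1 (hmin (by push_cast at hlo; omega))
  · exact hstab (by omega)

end Dynamics

theorem mainTheorem1 (p n : ℕ) (hp : p.Prime) (hp5 : 5 ≤ p) (hW : ¬ IsWolstenholmePrime p)
    (hpn : ¬ p ∣ n) (hn : 3 ≤ nuH p n) :
    (4 ≤ nuH p n →
      nuH p (p * n) = 2 ∧ ∀ m : ℕ, nuH p (p ^ m * (p * n)) = nuH p (p * n) - m) ∧
    (nuH p n = 3 → (¬ ∃ m : ℕ, nuH p (p ^ m * n) ≤ 2) →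
      ∀ m : ℕ, nuH p (p ^ m * n) = 2 * m + 3) ∧
    (nuH p n = 3 → (∃ m : ℕ, nuH p (p ^ m * n) ≤ 2) →
      ∃ M : ℕ, nuH p (p ^ M * n) = 0 ∧
        ∀ m : ℕ,
          ((m : ℚ) < M / 3 - 1 → nuH p (p ^ m * n) = 2 * m + 3) ∧
          ((m : ℚ) = M / 3 - 1 → 2 * m + 3 ≤ nuH p (p ^ m * n)) ∧
          ((M : ℚ) / 3 - 1 < m → nuH p (p ^ m * n) = M - m)) := by
  have : Fact p.Prime := ⟨hp⟩
  have hB : ¬ (p : ℤ) ∣ (bernoulli (p - 3)).num := fun h => hW ⟨hp, h⟩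
  obtain ⟨t, ht⟩ : ∃ t : ℕ → ℤ, ∀ m, t m = m + nuH p (p ^ m * n) := ⟨_, fun _ => rfl⟩
  have hstep : ∀ m : ℕ, (t m < 3 * m + 3 → t (m + 1) = t m) ∧
      (3 * m + 3 < t m → t (m + 1) = 3 * m + 3) ∧ (t m = 3 * m + 3 → 3 * m + 3 ≤ t (m + 1)) := by
    intro m
    rw [ht, ht]
    exact nuH_step hp5 hB hpn m
  have hlt := fun m => (hstep m).1
  have hgt := fun m => (hstep m).2.1
  have heq := fun m => (hstep m).2.2
  have ht0 : t 0 = nuH p n := by simp [ht]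
  have hnu : ∀ m, nuH p (p ^ m * n) = t m - m := fun m => by rw [ht]; ring
  refine ⟨fun h4 => ?_, fun _ hno m => ?_, fun _ hex => ?_⟩
  · have h1 : t 1 = 3 := by simpa using hgt 0 (by rw [ht0]; push_cast; omega)
    have hall : ∀ m : ℕ, nuH p (p ^ m * (p * n)) = 2 - m := by
      intro m
      rw [← mul_assoc, ← pow_succ, hnu,
        eq_of_lt_of_step hlt (m₀ := 1) (by rw [h1]; norm_num) (Nat.le_add_left 1 m), h1]
      push_cast
      ring
    have h2 : nuH p (p * n) = 2 := by simpa using hall 0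
    exact ⟨h2, fun m => by rw [h2, hall]⟩
  · have hge : ∀ m : ℕ, ¬ t m < 3 * m + 3 := by
      intro m hm
      -- Once t is frozen, the valuation t - j falls without bound; this j makes it nonpositive.
      refine hno ⟨m + (t m).toNat, ?_⟩
      rw [hnu, eq_of_lt_of_step hlt hm (Nat.le_add_right _ _)]
      have := Int.self_le_toNat (t m)
      push_cast
      omega
    rw [hnu, eq_of_not_lt_of_step hgt (hge m) (hge (m + 1))]
    ring
  · obtain ⟨k, hk⟩ := hex
    obtain ⟨M, hM, hall⟩ := exists_limit_of_step hlt hgt heq (ht0 ▸ hn)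
      ⟨k, by rw [hnu] at hk; omega⟩
    refine ⟨M, by rw [hnu, hM, sub_self], fun m => ⟨fun h => ?_, fun h => ?_, fun h => ?_⟩⟩
    · have h' : (3 * m + 3 : ℚ) < M := by linarith
      rw [hnu, (hall m).1 (by exact_mod_cast h')]
      ring
    · have h' : (3 * m + 3 : ℚ) = M := by linarith
      have := (hall m).2.1 (by exact_mod_cast h')
      rw [hnu]
      linarith
    · have h' : (M : ℚ) < 3 * m + 3 := by linarith
      rw [hnu, (hall m).2.2 (by exact_mod_cast h')]
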